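/- Setup. For $x\in[-1,1]$ let $W(x)=\begin{pmatrix}x & i\sqrt{1-x^2}\\ i\sqrt{1-x^2} & x\end{pmatrix}$ and $Z=\mathrm{diag}(1,-1)$. For $\Psi=(\psi_0,\dots,\psi_d)\in\mathbb{R}^{d+1}$ put $$U(x,\Psi)=e^{i\psi_0Z}\prod_{j=1}^{d}\bigl[W(x)e^{i\psi_jZ}\bigr].$$ Fix a parity $p\in\{0,1\}$. Reduced phase factors $\Phi=(\phi_0,\dots,\phi_n)$ encode the symmetric phase factors $\Psi$ with $d=2n+p$, namely $\Psi=(\phi_n,\dots,\phi_1,2\phi_0,\phi_1,\dots,\phi_n)$ if $p=0$ and $\Psi=(\phi_n,\dots,\phi_1,\phi_0,\phi_0,\phi_1,\dots,\phi_n)$ if $p=1$; write $g(x,\Phi)=\operatorname{Im}\langle 0|U(x,\Psi)|0\rangle$. Let $\mathbb{R}^\infty$ be the space of finitely supported real sequences indexed by $0,1,2,\dots$, let $\ell^1$ be the space of real sequences with $\|v\|_1=\sum_{k\ge0}|v_k|<\infty$, and let $B(0,r)=\{v\in\ell^1:\|v\|_1<r\}$. Let $T_k$ be the Chebyshev polynomials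 of the first kind. Let $$h(x)=2\cosh(2x)-2,\qquad H(x)=4x-\sinh(2x),\qquad r_\Phi=h^{-1}(2)\ (\text{with } h \text{ on } [0,\infty)),\qquad r_c=H(r_\Phi),$$ and let $H^{-1}:[0,r_c]\to[0,r_\Phi]$ be the inverse of the increasing bijection $H:[0,r_\Phi]\to[0,r_c]$. Theorem. For each parity $p\in\{0,1\}$ the following hold. 1. For $\Phi\in\mathbb{R}^\infty$ there is a unique $c=:F(\Phi)\in\mathbb{R}^\infty$ with $g(x,(\phi_0,\dots,\phi_n))=\sum_{j}c_jT_{2j+p}(x)$ for all $x\in[-1,1]$, and it is the same for every $n$ such that $\phi_k=0$ for all $k>n$. This defines the map $F:\mathbb{R}^\infty\to\mathbb{R}^\infty$. 2. $F$ extends to a continuous map $\overline F:\ell^1\to\ell^1$, and this continuous extension is unique. 3. $\overline F$ has an inverse map $\overline F^{-1}:B(0,r_c)\to\ell^1$, with $r_c\approx0.902$ (more precisely $|r_c-0.902|<0.0005$). That is, for every $c\in\ell^1$ with $\|c\|_1<r_c$ one has $\overline F^{-1}(c)\in B(0,r_\Phi)$ and $\overline F(\overline F^{-1}(c))=c$;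 and $\overline F^{-1}(\overline F(\Phi))=\Phi$ for every $\Phi\in B(0,r_\Phi)$ with $\overline F(\Phi)\in B(0,r_c)$. Moreover, for every $c\in\ell^1$ with $\|c\|_1<r_c$, $$\|\overline F^{-1}(c)\|_1\le H^{-1}(\|c\|_1).$$ -/

import Mathlib

namespace QSP

open Polynomial

noncomputable section

/-- The signal matrix `W(x) = exp(i arccos(x) X)`, for `x ∈ [-1, 1]`. -/
def W (x : ℝ) : Matrix (Fin 2) (Fin 2) ℂ :=
  !![(x : ℂ), Complex.I * (Real.sqrt (1 - x ^ 2) : ℂ);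
     Complex.I * (Real.sqrt (1 - x ^ 2) : ℂ), (x : ℂ)]

/-- The phase rotation `exp(i ψ Z)`. -/
def expZ (ψ : ℝ) : Matrix (Fin 2) (Fin 2) ℂ :=
  !![Complex.exp (Complex.I * ψ), 0; 0, Complex.exp (-(Complex.I * ψ))]

/-- The QSP unitary `U(x, Ψ) = exp(i ψ₀ Z) ∏_{j=1}^d [W(x) exp(i ψ_j Z)]` (ordered product)
for a full set of phase factors `Ψ = (ψ₀, …, ψ_d)`. -/
def qspU (x : ℝ) {d : ℕ} (Ψ : Fin (d + 1) → ℝ) : Matrix (Fin 2) (Fin 2) ℂ :=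
  expZ (Ψ 0) * (List.ofFn fun j : Fin d => W x * expZ (Ψ j.succ)).prod

/-- `Im ⟨0|U(x, Ψ)|0⟩` for a full set of phase factors. -/
def gFull (x : ℝ) {d : ℕ} (Ψ : Fin (d + 1) → ℝ) : ℝ := (qspU x Ψ 0 0).im

/-- The full symmetric set of phase factors `(ψ₀, …, ψ_d)`, `d = 2 n + p`, with reduced phase
factors `(φ₀, …, φ_n)`. For `p = 0` it is `(φ_n, …, φ₁, 2 φ₀, φ₁, …, φ_n)`; for `p = 1` it is
`(φ_n, …, φ₁, φ₀, φ₀, φ₁, …, φ_n)`. -/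
def fullPhases (p : Fin 2) (n : ℕ) (φ : ℕ → ℝ) : Fin (2 * n + (p : ℕ) + 1) → ℝ := fun j =>
  if 2 * (j : ℕ) = 2 * n + (p : ℕ) then 2 * φ 0
  else φ (Int.natAbs (2 * ((j : ℕ) : ℤ) - (2 * (n : ℤ) + ((p : ℕ) : ℤ))) / 2)

/-- `g(x, (φ₀, …, φ_n)) = Im ⟨0|U(x, Ψ)|0⟩`, where `Ψ` is the symmetric set of phase factors
of parity `p` with reduced phase factors `(φ₀, …, φ_n)`. -/
def g (p : Fin 2) (n : ℕ) (x : ℝ) (φ : ℕ → ℝ) : ℝ := gFull x (fullPhases p n φ)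

/-- The polynomial function `∑_j c_j T_{2j+p}(x)` of parity `p` with Chebyshev coefficient
vector `c`. -/
def chebSum (p : Fin 2) (c : ℕ →₀ ℝ) (x : ℝ) : ℝ :=
  c.sum fun j a => a * (Chebyshev.T ℝ (2 * (j : ℤ) + ((p : ℕ) : ℤ))).eval x

/-- Index of the last nonzero entry of a finitely supported vector (`0` for the zero vector). -/
def lastIndex (Φ : ℕ →₀ ℝ) : ℕ := Φ.support.sup id

/-! The function `g(·, Φ)` is a real polynomial of parity `p`, so that it has a (finitely
supported) vector of Chebyshev coefficients. -/

/-- Span of the Chebyshev polynomials `T_k`, `k ≡ m mod 2`. -/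
def spanT (m : ℤ) : Submodule ℂ ℂ[X] :=
  Submodule.span ℂ {q | ∃ k : ℤ, Even (k - m) ∧ q = Chebyshev.T ℂ k}

/-- Span of the Chebyshev polynomials `U_{k-1}`, `k ≡ m mod 2`. -/
def spanU (m : ℤ) : Submodule ℂ ℂ[X] :=
  Submodule.span ℂ {q | ∃ k : ℤ, Even (k - m) ∧ q = Chebyshev.U ℂ (k - 1)}

theorem T_mem_spanT {k m : ℤ} (h : Even (k - m)) : Chebyshev.T ℂ k ∈ spanT m :=
  Submodule.subset_span ⟨k, h, rfl⟩

theorem U_mem_spanU {k m : ℤ} (h : Even (k + 1 - m)) : Chebyshev.U ℂ k ∈ spanU m :=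
  Submodule.subset_span ⟨k + 1, h, by congr 1; ring⟩

theorem mem_of_two_mul {N : Submodule ℂ ℂ[X]} {a b : ℂ[X]} (h : 2 * a = b) (hb : b ∈ N) :
    a ∈ N := by
  have : a = (2⁻¹ : ℂ) • b := by
    subst h
    rw [← C_mul', ← mul_assoc, show (2 : ℂ[X]) = C 2 from rfl, ← C_mul]; simp
  rw [this]
  exact N.smul_mem _ hb

theorem mul_mem_of_span {s : Set ℂ[X]} {N : Submodule ℂ ℂ[X]} (r : ℂ[X])
    (h : ∀ q ∈ s, r * q ∈ N) {P : ℂ[X]} (hP : P ∈ Submodule.span ℂ s) : r * P ∈ N :=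
  (Submodule.map_span_le (LinearMap.mulLeft ℂ r) s N).2 h (Submodule.mem_map_of_mem hP)

theorem X_mul_mem_spanT {m : ℤ} {P : ℂ[X]} (hP : P ∈ spanT m) : X * P ∈ spanT (m + 1) := by
  refine mul_mem_of_span X ?_ hP
  rintro _ ⟨k, hk, rfl⟩
  refine mem_of_two_mul (b := Chebyshev.T ℂ (k + 1) + Chebyshev.T ℂ (k - 1))
    (by rw [Chebyshev.T_add_one]; ring) (add_mem (T_mem_spanT ?_) (T_mem_spanT ?_)) <;> grind

theorem sub_mul_mem_spanT {m : ℤ} {Q : ℂ[X]} (hQ : Q ∈ spanU m) :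
    (1 - X ^ 2) * Q ∈ spanT (m + 1) := by
  refine mul_mem_of_span (1 - X ^ 2) ?_ hQ
  rintro _ ⟨k, hk, rfl⟩
  refine mem_of_two_mul (b := Chebyshev.T ℂ (k - 1) - Chebyshev.T ℂ (k + 1)) ?_
    (sub_mem (T_mem_spanT ?_) (T_mem_spanT ?_))
  · rw [Chebyshev.one_sub_X_sq_mul_U_eq_pol_in_T, show k - 1 + 2 = k + 1 by ring,
      show k - 1 + 1 = k by ring, Chebyshev.T_add_one]
    ring
  all_goals grind

theorem mem_spanU {m : ℤ} {P : ℂ[X]} (hP : P ∈ spanT m) : P ∈ spanU (m + 1) := by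
  refine (Submodule.span_le (p := spanU (m + 1))).2 ?_ hP
  rintro _ ⟨k, hk, rfl⟩
  refine mem_of_two_mul (b := Chebyshev.U ℂ k - Chebyshev.U ℂ (k - 2))
    (by simpa using Chebyshev.two_mul_T_eq_U_sub_U ℂ (k - 2))
    (sub_mem (U_mem_spanU ?_) (U_mem_spanU ?_)) <;> grind

theorem X_mul_mem_spanU {m : ℤ} {Q : ℂ[X]} (hQ : Q ∈ spanU m) : X * Q ∈ spanU (m + 1) := by
  refine mul_mem_of_span X ?_ hQ
  rintro _ ⟨k, hk, rfl⟩
  refine mem_of_two_mul (b := Chebyshev.U ℂ k + Chebyshev.U ℂ (k - 2))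
    (by rw [Chebyshev.U_eq ℂ k]; ring) (add_mem (U_mem_spanU ?_) (U_mem_spanU ?_)) <;> grind

theorem qspU_succ (x : ℝ) {d : ℕ} (Ψ : Fin (d + 1 + 1) → ℝ) :
    qspU x Ψ = qspU x (fun j : Fin (d + 1) => Ψ j.castSucc) * (W x * expZ (Ψ (Fin.last _))) := by
  simp only [qspU, List.ofFn_succ', List.prod_concat, mul_assoc]
  rfl

theorem qspU_poly : ∀ {d : ℕ} (Ψ : Fin (d + 1) → ℝ), ∃ P ∈ spanT d, ∃ Q ∈ spanU d,
    ∀ x ∈ Set.Icc (-1 : ℝ) 1, qspU x Ψ 0 0 = P.eval (x : ℂ) ∧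
      qspU x Ψ 0 1 = Complex.I * (Real.sqrt (1 - x ^ 2) : ℂ) * Q.eval (x : ℂ)
  | 0, Ψ => by
    refine ⟨Complex.exp (Complex.I * Ψ 0) • 1, Submodule.smul_mem _ _ ?_, 0, zero_mem _, ?_⟩
    · rw [← Chebyshev.T_zero]
      exact T_mem_spanT (by simp)
    · intro x _
      simp [qspU, expZ]
  | d + 1, Ψ => by
    obtain ⟨P, hP, Q, hQ, h⟩ := qspU_poly (fun j : Fin (d + 1) => Ψ j.castSucc)
    set z : ℂ := Complex.I * (Ψ (Fin.last _) : ℂ) with hz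
    refine ⟨Complex.exp z • (X * P - (1 - X ^ 2) * Q), ?_,
      Complex.exp (-z) • (P + X * Q), ?_, ?_⟩
    · push_cast
      exact Submodule.smul_mem _ _ (sub_mem (X_mul_mem_spanT hP) (sub_mul_mem_spanT hQ))
    · push_cast
      exact Submodule.smul_mem _ _ (add_mem (mem_spanU hP) (X_mul_mem_spanU hQ))
    · intro x hx
      obtain ⟨h0, h1⟩ := h x hx
      have hs : ((Real.sqrt (1 - x ^ 2) : ℝ) : ℂ) ^ 2 = 1 - (x : ℂ) ^ 2 := by
        rw [← Complex.ofReal_pow, Real.sq_sqrt (by nlinarith [hx.1, hx.2])]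
        push_cast
        ring
      rw [qspU_succ]
      simp only [Matrix.mul_apply, Fin.sum_univ_two, h0, h1, W, expZ, ← hz, Matrix.of_apply,
        Matrix.cons_val_zero, Matrix.cons_val_one, Matrix.cons_val', Matrix.cons_val_fin_one,
        eval_smul, eval_sub, eval_add, eval_mul, eval_X, eval_one, eval_pow, smul_eq_mul]
      constructor
      · linear_combination (Complex.I ^ 2 * Complex.exp z * eval (x : ℂ) Q) * hs +
          (1 - (x : ℂ) ^ 2) * Complex.exp z * eval (x : ℂ) Q * Complex.I_sq
      · ring

theorem chebSum_add (p : Fin 2) (c c' : ℕ →₀ ℝ) (x : ℝ) :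
    chebSum p (c + c') x = chebSum p c x + chebSum p c' x :=
  Finsupp.sum_add_index' (by simp) (by intros; ring)

theorem chebSum_smul (p : Fin 2) (a : ℝ) (c : ℕ →₀ ℝ) (x : ℝ) :
    chebSum p (a • c) x = a * chebSum p c x := by
  rw [chebSum, Finsupp.sum_smul_index (by simp), chebSum, Finsupp.mul_sum]
  simp only [mul_assoc]

theorem spanT_cheb (p : Fin 2) (n : ℕ) {P : ℂ[X]} (hP : P ∈ spanT ((2 * n + (p : ℕ) : ℕ) : ℤ)) :
    ∃ c c' : ℕ →₀ ℝ, ∀ x : ℝ,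
      P.eval (x : ℂ) = (chebSum p c x : ℂ) + (chebSum p c' x : ℂ) * Complex.I := by
  induction hP using Submodule.span_induction with
  | mem q hq =>
    obtain ⟨k, hk, rfl⟩ := hq
    obtain ⟨j, hj⟩ : ∃ j : ℕ, (k.natAbs : ℤ) = 2 * j + ((p : ℕ) : ℤ) := by
      refine ⟨k.natAbs / 2, ?_⟩
      have hp := p.2
      obtain ⟨t, ht⟩ := hk
      push_cast at ht
      lia
    refine ⟨Finsupp.single j 1, 0, fun x => ?_⟩
    rw [← Chebyshev.T_natAbs, hj]
    simp only [chebSum, zero_mul, Finsupp.sum_single_index, one_mul, Finsupp.sum_zero_index,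
      Complex.ofReal_zero, add_zero]
    rw [← Chebyshev.map_T (algebraMap ℝ ℂ), eval_map_algebraMap, ← Complex.coe_algebraMap,
      aeval_algebraMap_apply]
    rfl
  | zero => exact ⟨0, 0, fun x => by simp [chebSum]⟩
  | add P Q _ _ hP hQ =>
    obtain ⟨a, a', ha⟩ := hP
    obtain ⟨b, b', hb⟩ := hQ
    refine ⟨a + b, a' + b', fun x => ?_⟩
    rw [eval_add, ha, hb, chebSum_add, chebSum_add]
    push_cast
    ring
  | smul z P _ hP =>
    obtain ⟨a, a', ha⟩ := hP
    refine ⟨z.re • a + (-z.im) • a', z.im • a + z.re • a', fun x => ?_⟩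
    rw [eval_smul, ha]
    simp only [chebSum_add, chebSum_smul, smul_eq_mul]
    apply Complex.ext <;> simp <;> ring

/-- `g(·, Φ)` is a finite Chebyshev sum of parity `p` on `[-1, 1]`. -/
theorem exists_chebCoeffs (p : Fin 2) (Φ : ℕ →₀ ℝ) : ∃ c : ℕ →₀ ℝ,
    ∀ x ∈ Set.Icc (-1 : ℝ) 1, g p (lastIndex Φ) x Φ = chebSum p c x := by
  obtain ⟨P, hP, Q, _, h⟩ := qspU_poly (fullPhases p (lastIndex Φ) Φ)
  obtain ⟨c, c', hc⟩ := spanT_cheb p _ hP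
  refine ⟨c', fun x hx => ?_⟩
  rw [g, gFull, (h x hx).1, hc]
  simp

/-- The map `F : ℝ^∞ → ℝ^∞` sending reduced phase factors to the vector of Chebyshev
coefficients of `g(·, Φ)`, for parity `p`. (The vector is unique: distinct Chebyshev polynomials
are linearly independent as functions on `[-1, 1]`.) -/
def F (p : Fin 2) (Φ : ℕ →₀ ℝ) : ℕ →₀ ℝ := (exists_chebCoeffs p Φ).choose

/-- The Banach space `ℓ¹` of absolutely summable real sequences. -/
abbrev ell1 : Type := lp (fun _ : ℕ => ℝ) 1

/-- The inclusion `ℝ^∞ ⊆ ℓ¹`. -/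
def toEll1 (Φ : ℕ →₀ ℝ) : ell1 :=
  ⟨fun k => Φ k, memℓp_gen (summable_of_ne_finset_zero (s := Φ.support) fun k hk => by
    simp [Finsupp.notMem_support_iff.1 hk])⟩

/-- `h(x) = 2 cosh(2x) - 2`. -/
def h (x : ℝ) : ℝ := 2 * Real.cosh (2 * x) - 2

/-- `H(x) = 4x - sinh(2x)`. -/
def H (x : ℝ) : ℝ := 4 * x - Real.sinh (2 * x)

/-- `r_Φ = h⁻¹(2)`, with `h` restricted to `[0, ∞)`, where it is injective. -/
def rPhi : ℝ := Function.invFunOn h (Set.Ici 0) 2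

/-- `r_c = H(r_Φ)`. -/
def rc : ℝ := H rPhi

/-- `H⁻¹ : [0, r_c] → [0, r_Φ]`, the inverse of the increasing bijection
`H : [0, r_Φ] → [0, r_c]`. -/
def HInv (y : ℝ) : ℝ := Function.invFunOn H (Set.Icc 0 rPhi) y

theorem h_strictMonoOn : StrictMonoOn h (Set.Ici 0) := by
  intro a ha b hb hab
  have ha' : (0 : ℝ) ≤ a := ha
  have hb' : (0 : ℝ) ≤ b := hb
  have := Real.cosh_strictMonoOn (a := 2 * a) (b := 2 * b) (by simpa using ha')
    (by simpa using hb') (by linarith)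
  simp only [h]
  linarith

theorem rPhi_spec : 0 ≤ rPhi ∧ h rPhi = 2 := by
  have hc : ContinuousOn h (Set.Icc 0 2) := by
    unfold h; fun_prop
  have hmem : (2 : ℝ) ∈ h '' Set.Icc 0 2 := by
    refine intermediate_value_Icc (by norm_num) hc ⟨by simp [h], ?_⟩
    have h1 := Real.add_one_le_exp (2 * 2 : ℝ)
    have h2 := Real.exp_pos (-(2 * 2) : ℝ)
    rw [h, Real.cosh_eq]
    generalize Real.exp (2 * 2) = a at *
    generalize Real.exp (-(2 * 2)) = b at *
    linarith
  have hex : ∃ a ∈ Set.Ici (0 : ℝ), h a = 2 := by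
    obtain ⟨a, ha, hh⟩ := hmem
    exact ⟨a, ha.1, hh⟩
  exact ⟨Function.invFunOn_mem hex, Function.invFunOn_eq hex⟩

theorem H_strictMonoOn : StrictMonoOn H (Set.Icc 0 rPhi) := by
  have hd : ∀ x, HasDerivAt H (2 - h x) x := by
    intro x
    have h1 : HasDerivAt (fun x : ℝ => 2 * x) 2 x := by
      simpa using (hasDerivAt_id x).const_mul (2 : ℝ)
    have h2 := ((hasDerivAt_id x).const_mul (4 : ℝ)).sub h1.sinh
    have h3 : 2 - h x = 4 * 1 - Real.cosh (2 * x) * 2 := by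
      rw [h]; ring
    rw [h3]
    exact h2
  refine strictMonoOn_of_deriv_pos (convex_Icc _ _)
    (fun x _ => (hd x).continuousAt.continuousWithinAt) fun x hx => ?_
  rw [interior_Icc] at hx
  rw [(hd x).deriv]
  have := h_strictMonoOn (a := x) (b := rPhi) hx.1.le rPhi_spec.1 hx.2
  linarith [rPhi_spec.2]

theorem HInv_spec {y : ℝ} (hy : y ∈ Set.Icc 0 rc) : HInv y ∈ Set.Icc 0 rPhi ∧ H (HInv y) = y := by
  have hc : ContinuousOn H (Set.Icc 0 rPhi) := by
    unfold H; fun_prop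
  have h0 : H 0 = 0 := by simp [H]
  have hex : ∃ a ∈ Set.Icc 0 rPhi, H a = y :=
    intermediate_value_Icc rPhi_spec.1 hc ⟨by rw [h0]; exact hy.1, hy.2⟩
  exact ⟨Function.invFunOn_mem hex, Function.invFunOn_eq hex⟩

end

end QSP

/-!
Put `x = cos θ`, `w = e^{iθ}`. In the eigenbasis of `X` the matrix `W(x)` is `D = diag(w, w⁻¹)` and
`e^{iψZ}` becomes `e^{iψX} = cos ψ + i sin ψ X`. Since `X D = D⁻¹ X`, every partial product of
`U(x, Ψ)` has the form `a(D) + i b(D) X`, where `a`, `b` are Laurent polynomials with real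
coefficients, and one more factor changes `(a, b)` by the linear recursion `evolve`. The wanted
function is `g(cos θ, Φ) = Re b(w)`, so the Chebyshev coefficients of `g` are obtained by folding
those of `b`, and folding does not increase the `ℓ¹` norm (`norm_toEll1_le_of_re_evalAt_eq`).

Multiplication by `w` is an isometry of `ℓ¹(ℤ)`, and `|cos|`, `|sin|` are dominated by `cosh`, `sinh`.
Hence the recursion is majorized by the addition formulas of `cosh` and `sinh`. Each reduced phase
occurs twice in `Ψ`, so the linear part of `F` is `2 Φ`, and the majorants give
`‖F Φ - 2 Φ‖ ≤ sinh (2 ‖Φ‖) - 2 ‖Φ‖` (`norm_F_sub_two_smul_le`). The same argument for the derivative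
along a segment shows that `F - 2` is Lipschitz with constant `2 cosh (2 r) - 2 = h r` on the ball of
radius `r` (`norm_F_sub_F_sub_le`).

A locally Lipschitz map on the dense subspace of finitely supported sequences extends to `ℓ¹` with the
same estimates (`exists_extension`). On the ball of radius `r_Φ`, where `h < 2`, the extension is
injective. If `‖c‖ < r_c` and `ρ = H⁻¹ ‖c‖`, then `(‖c‖ + sinh (2 ρ) - 2 ρ) / 2 = ρ` by the definition
of `H`, so that `Φ ↦ Φ + (c - F Φ) / 2` maps the closed ball of radius `ρ` to itself. It is a
contraction there, and its fixed point is the preimage of `c` (`exists_map_eq`).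
-/

namespace QSP

open Polynomial

noncomputable section

/-! ### Scalar majorants -/

theorem abs_sin_le_sinh_abs (x : ℝ) : |Real.sin x| ≤ Real.sinh |x| :=
  Real.abs_sin_le_abs.trans (Real.self_le_sinh_iff.2 (abs_nonneg x))

theorem one_sub_cos_le (x : ℝ) : 1 - Real.cos x ≤ Real.cosh x - 1 := by
  have h1 := Real.cos_sq' (x / 2)
  have h2 := Real.cosh_sq (x / 2)
  have h3 : Real.cos x = 2 * Real.cos (x / 2) ^ 2 - 1 := by
    rw [← Real.cos_two_mul]; ring_nf
  have h4 : Real.cosh x = Real.cosh (x / 2) ^ 2 + Real.sinh (x / 2) ^ 2 := by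
    rw [← Real.cosh_two_mul]; ring_nf
  have h5 : Real.sin (x / 2) ^ 2 ≤ Real.sinh (x / 2) ^ 2 := by
    have := abs_sin_le_sinh_abs (x / 2)
    rw [← Real.abs_sinh] at this
    exact sq_le_sq.2 this
  linarith

theorem abs_cos_sub_one_le (x : ℝ) : |Real.cos x - 1| ≤ Real.cosh |x| - 1 := by
  rw [abs_of_nonpos (by linarith [Real.cos_le_one x]), Real.cosh_abs]
  linarith [one_sub_cos_le x]

theorem abs_sin_sub_self_le (x : ℝ) : |Real.sin x - x| ≤ Real.sinh |x| - |x| := by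
  have key : ∀ y : ℝ, 0 ≤ y → |Real.sin y - y| ≤ Real.sinh y - y := by
    intro y hy
    rw [abs_of_nonpos (by linarith [Real.sin_le hy])]
    have hd : ∀ z : ℝ, HasDerivAt (fun z => Real.sinh z + Real.sin z - 2 * z)
        (Real.cosh z + Real.cos z - 2) z := fun z => by
      simpa using! ((Real.hasDerivAt_sinh z).add (Real.hasDerivAt_sin z)).sub
        ((hasDerivAt_id z).const_mul 2)
    have := monotone_of_deriv_nonneg (fun z => (hd z).differentiableAt)
      (fun z => by rw [(hd z).deriv]; linarith [one_sub_cos_le z]) hy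
    simp only [Real.sinh_zero, Real.sin_zero] at this
    linarith
  rcases le_total 0 x with hx | hx
  · simpa [abs_of_nonneg hx] using key x hx
  · have := key (-x) (by linarith)
    rw [Real.sin_neg, show -Real.sin x - -x = -(Real.sin x - x) by ring, abs_neg] at this
    simpa [abs_of_nonpos hx] using this

theorem abs_cos_le_cosh_abs (x : ℝ) : |Real.cos x| ≤ Real.cosh |x| :=
  (Real.abs_cos_le_one x).trans (Real.one_le_cosh _)

/-! ### The recursion for the coefficients and its majorants -/

section Evolution

variable {E : Type*} [NormedAddCommGroup E] [NormedSpace ℝ E]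

/-- Coefficients of the partial products of a QSP sequence. In the eigenbasis of `X` the factor
`W(cos θ) e^{iψZ}` is `D e^{iψX}` with `D = diag(e^{iθ}, e^{-iθ})`, and the product of the first `k`
factors has the form `a(D) + i b(D) X` with real Laurent series `a`, `b`. Since `X D = D⁻¹ X`, the
next factor sends `(a, b)` to
`(cos ψ · D a - sin ψ · D⁻¹ b, cos ψ · D⁻¹ b + sin ψ · D a)`. The space of Laurent series is
abstracted to a normed space `E`, and multiplication by `D` to an isometry `τ`. -/
def evolve (τ : E ≃ₗᵢ[ℝ] E) (e : E) (ψ : ℕ → ℝ) : ℕ → E × E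
  | 0 => (e, 0)
  | k + 1 =>
    (Real.cos (ψ k) • τ (evolve τ e ψ k).1 - Real.sin (ψ k) • τ.symm (evolve τ e ψ k).2,
      Real.cos (ψ k) • τ.symm (evolve τ e ψ k).2 + Real.sin (ψ k) • τ (evolve τ e ψ k).1)

/-- The part of `(evolve τ e ψ k).2` that is linear in the phases `ψ`. -/
def evolveLin (τ : E ≃ₗᵢ[ℝ] E) (e : E) (ψ : ℕ → ℝ) : ℕ → E
  | 0 => 0
  | k + 1 => τ.symm (evolveLin τ e ψ k) + ψ k • (τ ^ (k + 1)) e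

variable {τ : E ≃ₗᵢ[ℝ] E} {e : E}

/-- Prepending a zero phase multiplies the initial vector by `D`. -/
theorem evolve_succ_of_zero {ψ : ℕ → ℝ} (h0 : ψ 0 = 0) (k : ℕ) :
    evolve τ e ψ (k + 1) = evolve τ (τ e) (fun j => ψ (j + 1)) k := by
  induction k with
  | zero => simp [evolve, h0]
  | succ k ih => rw [evolve, ih]; rfl

theorem evolve_map_apply (ψ : ℕ → ℝ) (k : ℕ) :
    evolve τ (τ e) ψ k = (τ (evolve τ e ψ k).1, τ (evolve τ e ψ k).2) := by
  induction k with
  | zero => simp [evolve]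
  | succ k ih => simp [evolve, ih]

theorem norm_pow_apply (k : ℕ) (v : E) : ‖(τ ^ k) v‖ = ‖v‖ := (τ ^ k).norm_map v

/-- Majorants of the coefficients: replacing `cos`, `sin` by `cosh`, `sinh` and every vector by its
norm turns the recursion into the addition formulas of `cosh` and `sinh`. -/
theorem evolve_bounds (he : ‖e‖ ≤ 1) (ψ : ℕ → ℝ) (k : ℕ) :
    ‖(evolve τ e ψ k).1‖ ≤ Real.cosh (∑ j ∈ Finset.range k, |ψ j|) ∧
    ‖(evolve τ e ψ k).2‖ ≤ Real.sinh (∑ j ∈ Finset.range k, |ψ j|) ∧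
    ‖(evolve τ e ψ k).1 - (τ ^ k) e‖ ≤ Real.cosh (∑ j ∈ Finset.range k, |ψ j|) - 1 ∧
    ‖(evolve τ e ψ k).2 - evolveLin τ e ψ k‖ ≤
      Real.sinh (∑ j ∈ Finset.range k, |ψ j|) - ∑ j ∈ Finset.range k, |ψ j| := by
  induction k with
  | zero => simpa [evolve, evolveLin] using he
  | succ k ih =>
    obtain ⟨hC, hS, hC1, hSL⟩ := ih
    rw [Finset.sum_range_succ]
    set s := ∑ j ∈ Finset.range k, |ψ j|
    set C := (evolve τ e ψ k).1
    set S := (evolve τ e ψ k).2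
    set a := |ψ k|
    have hc := abs_cos_le_cosh_abs (ψ k)
    have hs := abs_sin_le_sinh_abs (ψ k)
    have hc1 := abs_cos_sub_one_le (ψ k)
    have hs1 := abs_sin_sub_self_le (ψ k)
    have hcs := Real.cosh_pos s
    have hss : 0 ≤ Real.sinh s := Real.sinh_nonneg_iff.2 (Finset.sum_nonneg fun _ _ => abs_nonneg _)
    have hsa : 0 ≤ Real.sinh a := Real.sinh_nonneg_iff.2 (abs_nonneg _)
    have hca := Real.cosh_pos a
    have hca1 := Real.one_le_cosh a
    have key (r t B : ℝ) (v : E) (hr : |r| ≤ t) (hv : ‖v‖ ≤ B) : ‖r • v‖ ≤ t * B := by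
      rw [norm_smul]
      exact mul_le_mul hr hv (norm_nonneg _) ((abs_nonneg r).trans hr)
    have nC : ‖τ C‖ ≤ Real.cosh s := by simpa using hC
    have nS : ‖τ.symm S‖ ≤ Real.sinh s := by simpa using hS
    have nC1 : ‖τ (C - (τ ^ k) e)‖ ≤ Real.cosh s - 1 := (τ.norm_map _).trans_le hC1
    have nSL : ‖τ.symm (S - evolveLin τ e ψ k)‖ ≤ Real.sinh s - s := (τ.symm.norm_map _).trans_le hSL
    have hpow : (τ ^ (k + 1)) e = τ ((τ ^ k) e) := by rw [pow_succ']; rfl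
    have ne : ‖τ ((τ ^ k) e)‖ ≤ 1 := by simpa [norm_pow_apply] using he
    simp only [evolve, evolveLin]
    rw [Real.cosh_add, Real.sinh_add]
    refine ⟨?_, ?_, ?_, ?_⟩
    · linarith [norm_sub_le (Real.cos (ψ k) • τ C) (Real.sin (ψ k) • τ.symm S),
        key _ _ _ _ hc nC, key _ _ _ _ hs nS]
    · linarith [norm_add_le (Real.cos (ψ k) • τ.symm S) (Real.sin (ψ k) • τ C),
        key _ _ _ _ hc nS, key _ _ _ _ hs nC]
    · have e1 : Real.cos (ψ k) • τ C - Real.sin (ψ k) • τ.symm S - (τ ^ (k + 1)) e =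
          ((Real.cos (ψ k) - 1) • τ C + τ (C - (τ ^ k) e)) - Real.sin (ψ k) • τ.symm S := by
        rw [hpow, map_sub, sub_smul, one_smul]; abel
      rw [e1]
      linarith [norm_sub_le ((Real.cos (ψ k) - 1) • τ C + τ (C - (τ ^ k) e))
        (Real.sin (ψ k) • τ.symm S), norm_add_le ((Real.cos (ψ k) - 1) • τ C) (τ (C - (τ ^ k) e)),
        key _ _ _ _ hc1 nC, key _ _ _ _ hs nS]
    · have e1 : Real.cos (ψ k) • τ.symm S + Real.sin (ψ k) • τ C -
          (τ.symm (evolveLin τ e ψ k) + ψ k • (τ ^ (k + 1)) e) =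
          ((Real.cos (ψ k) - 1) • τ.symm S + τ.symm (S - evolveLin τ e ψ k)) +
          (Real.sin (ψ k) • τ (C - (τ ^ k) e) + (Real.sin (ψ k) - ψ k) • τ ((τ ^ k) e)) := by
        simp only [hpow, map_sub, sub_smul, one_smul, smul_sub]; abel
      rw [e1]
      linarith [norm_add_le ((Real.cos (ψ k) - 1) • τ.symm S + τ.symm (S - evolveLin τ e ψ k))
          (Real.sin (ψ k) • τ (C - (τ ^ k) e) + (Real.sin (ψ k) - ψ k) • τ ((τ ^ k) e)),
        norm_add_le ((Real.cos (ψ k) - 1) • τ.symm S) (τ.symm (S - evolveLin τ e ψ k)),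
        norm_add_le (Real.sin (ψ k) • τ (C - (τ ^ k) e)) ((Real.sin (ψ k) - ψ k) • τ ((τ ^ k) e)),
        key _ _ _ _ hc1 nS, key _ _ _ _ hs nC1, key _ _ _ _ hs1 ne]

/-- Along a line `ψ + t η` in the space of phases, `evolve` is differentiable, and its derivative
has the majorant obtained by differentiating those of `evolve_bounds`. -/
theorem exists_hasDerivAt_evolve (he : ‖e‖ ≤ 1) (ψ η : ℕ → ℝ) (t : ℝ) (k : ℕ) :
    ∃ C' S' : E, HasDerivAt (fun u => (evolve τ e (fun j => ψ j + u * η j) k).1) C' t ∧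
      HasDerivAt (fun u => (evolve τ e (fun j => ψ j + u * η j) k).2) S' t ∧
      ‖C'‖ ≤ Real.sinh (∑ j ∈ Finset.range k, |ψ j + t * η j|) * ∑ j ∈ Finset.range k, |η j| ∧
      ‖S'‖ ≤ Real.cosh (∑ j ∈ Finset.range k, |ψ j + t * η j|) * ∑ j ∈ Finset.range k, |η j| ∧
      ‖S' - evolveLin τ e η k‖ ≤
        (Real.cosh (∑ j ∈ Finset.range k, |ψ j + t * η j|) - 1) * ∑ j ∈ Finset.range k, |η j| := by
  induction k with
  | zero =>
    exact ⟨0, 0, hasDerivAt_const _ _, hasDerivAt_const _ _, by simp, by simp, by simp [evolveLin]⟩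
  | succ k ih =>
    obtain ⟨C', S', dC, dS, hC', hS', hSL⟩ := ih
    obtain ⟨hC, hS, hC1, -⟩ := evolve_bounds (τ := τ) he (fun j => ψ j + t * η j) k
    rw [Finset.sum_range_succ, Finset.sum_range_succ]
    set s := ∑ j ∈ Finset.range k, |ψ j + t * η j|
    set σ := ∑ j ∈ Finset.range k, |η j|
    set x := ψ k + t * η k with hx
    have dx : HasDerivAt (fun u => ψ k + u * η k) (η k) t := by
      simpa using ((hasDerivAt_id t).mul_const (η k)).const_add (ψ k)
    have dcos := dx.cos
    have dsin := dx.sin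
    have dτC := τ.toContinuousLinearEquiv.toContinuousLinearMap.hasFDerivAt.comp_hasDerivAt t dC
    have dτS :=
      τ.symm.toContinuousLinearEquiv.toContinuousLinearMap.hasFDerivAt.comp_hasDerivAt t dS
    have d1 := (dcos.smul dτC).sub (dsin.smul dτS)
    have d2 := (dcos.smul dτS).add (dsin.smul dτC)
    refine ⟨_, _, d1, d2, ?_⟩
    set C := (evolve τ e (fun j => ψ j + t * η j) k).1 with hCdef
    set S := (evolve τ e (fun j => ψ j + t * η j) k).2 with hSdef
    simp only [ContinuousLinearEquiv.coe_coe, LinearIsometryEquiv.coe_toContinuousLinearEquiv,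
      Function.comp_apply, ← hCdef, ← hSdef, ← hx, evolveLin]
    set a := |x|
    have hc := abs_cos_le_cosh_abs x
    have hs := abs_sin_le_sinh_abs x
    have hc1 := abs_cos_sub_one_le x
    have hσ : 0 ≤ σ := Finset.sum_nonneg fun _ _ => abs_nonneg _
    have key (r t B : ℝ) (v : E) (hr : |r| ≤ t) (hv : ‖v‖ ≤ B) : ‖r • v‖ ≤ t * B := by
      rw [norm_smul]
      exact mul_le_mul hr hv (norm_nonneg _) ((abs_nonneg r).trans hr)
    have hη : |η k| ≤ |η k| := le_rfl
    have nC : ‖τ C‖ ≤ Real.cosh s := by simpa using hC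
    have nS : ‖τ.symm S‖ ≤ Real.sinh s := by simpa using hS
    have nC1 : ‖τ (C - (τ ^ k) e)‖ ≤ Real.cosh s - 1 := (τ.norm_map _).trans_le hC1
    have nC' : ‖τ C'‖ ≤ Real.sinh s * σ := by simpa using hC'
    have nS' : ‖τ.symm S'‖ ≤ Real.cosh s * σ := by simpa using hS'
    have nSL : ‖τ.symm (S' - evolveLin τ e η k)‖ ≤ (Real.cosh s - 1) * σ := (τ.symm.norm_map _).trans_le hSL
    have hpow : (τ ^ (k + 1)) e = τ ((τ ^ k) e) := by rw [pow_succ']; rfl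
    have k1 := key _ _ _ _ hc nC'
    have k2 := key _ _ _ _ hη (key _ _ _ _ hs nC)
    have k3 := key _ _ _ _ hs nS'
    have k4 := key _ _ _ _ hη (key _ _ _ _ hc nS)
    have k5 := key _ _ _ _ hc nS'
    have k6 := key _ _ _ _ hη (key _ _ _ _ hs nS)
    have k7 := key _ _ _ _ hs nC'
    have k8 := key _ _ _ _ hη (key _ _ _ _ hc nC)
    have k9 := key _ _ _ _ hc1 nS'
    have k10 := key _ _ _ _ hη (key _ _ _ _ hc1 nC)
    have k11 := key _ _ _ _ hη nC1
    have e1 : Real.cos x • τ C' + (-Real.sin x * η k) • τ C -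
        (Real.sin x • τ.symm S' + (Real.cos x * η k) • τ.symm S) =
        Real.cos x • τ C' - η k • Real.sin x • τ C -
        (Real.sin x • τ.symm S' + η k • Real.cos x • τ.symm S) := by
      module
    have e2 : Real.cos x • τ.symm S' + (-Real.sin x * η k) • τ.symm S +
        (Real.sin x • τ C' + (Real.cos x * η k) • τ C) =
        Real.cos x • τ.symm S' - η k • Real.sin x • τ.symm S +
        (Real.sin x • τ C' + η k • Real.cos x • τ C) := by
      module
    have e3 : Real.cos x • τ.symm S' + (-Real.sin x * η k) • τ.symm S +
        (Real.sin x • τ C' + (Real.cos x * η k) • τ C) -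
        (τ.symm (evolveLin τ e η k) + η k • (τ ^ (k + 1)) e) =
        (((Real.cos x - 1) • τ.symm S' - η k • Real.sin x • τ.symm S) +
        (τ.symm (S' - evolveLin τ e η k) + Real.sin x • τ C')) +
        (η k • (Real.cos x - 1) • τ C + η k • τ (C - (τ ^ k) e)) := by
      rw [hpow, map_sub, map_sub]
      module
    rw [Real.cosh_add, Real.sinh_add]
    refine ⟨?_, ?_, ?_⟩
    · rw [e1]
      refine (norm_sub_le _ _).trans ?_
      refine (add_le_add (norm_sub_le _ _) (norm_add_le _ _)).trans ?_
      linarith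
    · rw [e2]
      refine (norm_add_le _ _).trans ?_
      refine (add_le_add (norm_sub_le _ _) (norm_add_le _ _)).trans ?_
      linarith
    · rw [e3]
      refine (norm_add_le _ _).trans ?_
      refine (add_le_add ((norm_add_le _ _).trans
        (add_le_add (norm_sub_le _ _) (norm_add_le _ _))) (norm_add_le _ _)).trans ?_
      linarith

/-- The nonlinear part of `(evolve τ e ψ k).2` is Lipschitz on balls, with constant
`cosh s - 1` on the ball of radius `s`. -/
theorem norm_evolve_sub_sub_le (he : ‖e‖ ≤ 1) (ψ ψ' : ℕ → ℝ) (k : ℕ) {s : ℝ}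
    (hs : ∑ j ∈ Finset.range k, |ψ j| ≤ s) (hs' : ∑ j ∈ Finset.range k, |ψ' j| ≤ s) :
    ‖(evolve τ e ψ k).2 - (evolve τ e ψ' k).2 - evolveLin τ e (fun j => ψ j - ψ' j) k‖ ≤
      (Real.cosh s - 1) * ∑ j ∈ Finset.range k, |ψ j - ψ' j| := by
  set η : ℕ → ℝ := fun j => ψ j - ψ' j
  choose C' S' _ dS _ _ hSL using fun t => exists_hasDerivAt_evolve (τ := τ) he ψ' η t k
  have hd : ∀ t : ℝ, HasDerivAt
      (fun u => (evolve τ e (fun j => ψ' j + u * η j) k).2 - u • evolveLin τ e η k)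
      (S' t - evolveLin τ e η k) t := fun t => by
    simpa using! (dS t).sub ((hasDerivAt_id t).smul_const (evolveLin τ e η k))
  have hb : ∀ t ∈ Set.Ico (0 : ℝ) 1, ‖S' t - evolveLin τ e η k‖ ≤
      (Real.cosh s - 1) * ∑ j ∈ Finset.range k, |ψ j - ψ' j| := by
    intro t ht
    refine (hSL t).trans ?_
    -- the norm of the phases along the segment is at most the larger of those at the end points
    have hle : ∑ j ∈ Finset.range k, |ψ' j + t * η j| ≤ s := by
      have h1 : ∀ j, |ψ' j + t * η j| ≤ (1 - t) * |ψ' j| + t * |ψ j| := fun j => by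
        have : ψ' j + t * η j = (1 - t) * ψ' j + t * ψ j := by simp only [η]; ring
        rw [this]
        refine (abs_add_le _ _).trans ?_
        rw [abs_mul, abs_mul, abs_of_nonneg ht.1, abs_of_nonneg (sub_nonneg.2 ht.2.le)]
      calc _ ≤ ∑ j ∈ Finset.range k, ((1 - t) * |ψ' j| + t * |ψ j|) :=
            Finset.sum_le_sum fun j _ => h1 j
        _ = (1 - t) * ∑ j ∈ Finset.range k, |ψ' j| + t * ∑ j ∈ Finset.range k, |ψ j| := by
            rw [Finset.sum_add_distrib, Finset.mul_sum, Finset.mul_sum]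
        _ ≤ (1 - t) * s + t * s := add_le_add
            (mul_le_mul_of_nonneg_left hs' (sub_nonneg.2 ht.2.le))
            (mul_le_mul_of_nonneg_left hs ht.1)
        _ = s := by ring
    have h0 : 0 ≤ ∑ j ∈ Finset.range k, |ψ' j + t * η j| :=
      Finset.sum_nonneg fun _ _ => abs_nonneg _
    have hcosh := Real.cosh_le_cosh.2 (abs_le_abs_of_nonneg h0 hle)
    exact mul_le_mul_of_nonneg_right (by linarith) (Finset.sum_nonneg fun _ _ => abs_nonneg _)
  have := norm_image_sub_le_of_norm_deriv_le_segment_01'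
    (fun t _ => (hd t).hasDerivWithinAt) hb
  have hψ : (fun j => ψ' j + 1 * η j) = ψ := by funext j; simp [η]
  rw [hψ] at this
  simp only [zero_mul, add_zero, one_smul, zero_smul, sub_zero] at this
  rwa [sub_right_comm] at this

end Evolution

/-! ### Laurent series with summable coefficients -/

/-- Absolutely summable two-sided real sequences, read as the coefficients of Laurent series
`∑ vₖ wᵏ`. -/
abbrev LaurentL1 : Type := lp (fun _ : ℤ => ℝ) 1

theorem lp_one_norm_eq {ι : Type*} (v : lp (fun _ : ι => ℝ) 1) : ‖v‖ = ∑' k, |v k| := by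
  rw [lp.norm_eq_tsum_rpow (by simp)]
  simp

theorem lp_one_summable {ι : Type*} (v : lp (fun _ : ι => ℝ) 1) : Summable fun k => |v k| := by
  simpa using (lp.memℓp v).summable (by simp)

/-- Reindexing along a permutation, as an isometry of `ℓ¹(ℤ)`. -/
def reindexL1 (σ : ℤ ≃ ℤ) : LaurentL1 ≃ₗᵢ[ℝ] LaurentL1 where
  toFun v := ⟨fun k => v (σ k), memℓp_gen (by
    simpa using! (σ.summable_iff (f := fun k => |v k|)).2 (lp_one_summable v))⟩
  invFun v := ⟨fun k => v (σ.symm k), memℓp_gen (by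
    simpa using! (σ.symm.summable_iff (f := fun k => |v k|)).2 (lp_one_summable v))⟩
  map_add' _ _ := rfl
  map_smul' _ _ := rfl
  left_inv v := by ext k; simp
  right_inv v := by ext k; simp
  norm_map' v := by
    rw [lp_one_norm_eq, lp_one_norm_eq]
    exact σ.tsum_eq fun k => |v k|

/-- Multiplication of a Laurent series by `w`. -/
def shift : LaurentL1 ≃ₗᵢ[ℝ] LaurentL1 := reindexL1 (Equiv.subRight 1)

theorem summable_laurent (v : LaurentL1) (θ : ℝ) :
    Summable fun k : ℤ => (v k : ℂ) * Complex.exp (k * (θ * Complex.I)) := by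
  refine Summable.of_norm ((lp_one_summable v).congr fun k => ?_)
  rw [norm_mul, Complex.norm_real, show (k : ℂ) * (θ * Complex.I) = ((k * θ : ℝ) : ℂ) * Complex.I by
    push_cast; ring, Complex.norm_exp_ofReal_mul_I, mul_one, Real.norm_eq_abs]

/-- Evaluation of a Laurent series at `w = e^{iθ}`. -/
def evalAt (θ : ℝ) : LaurentL1 →ₗ[ℝ] ℂ where
  toFun v := ∑' k : ℤ, (v k : ℂ) * Complex.exp (k * (θ * Complex.I))
  map_add' u v := by
    rw [← (summable_laurent u θ).tsum_add (summable_laurent v θ)]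
    refine tsum_congr fun k => ?_
    rw [lp.coeFn_add, Pi.add_apply]
    push_cast
    ring
  map_smul' a v := by
    rw [RingHom.id_apply, ← (summable_laurent v θ).tsum_const_smul]
    refine tsum_congr fun k => ?_
    rw [lp.coeFn_smul, Pi.smul_apply, Complex.real_smul]
    push_cast [smul_eq_mul]
    ring

theorem evalAt_shift (θ : ℝ) (v : LaurentL1) :
    evalAt θ (shift v) = Complex.exp (θ * Complex.I) * evalAt θ v := by
  change ∑' k : ℤ, (v (k - 1) : ℂ) * Complex.exp (k * (θ * Complex.I)) = _ * ∑' k : ℤ, _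
  rw [← tsum_mul_left, ← (Equiv.addRight (1 : ℤ)).tsum_eq]
  refine tsum_congr fun k => ?_
  simp only [Equiv.coe_addRight, add_sub_cancel_right]
  push_cast
  rw [add_mul, Complex.exp_add]
  ring_nf

theorem evalAt_shift_symm (θ : ℝ) (v : LaurentL1) :
    evalAt θ (shift.symm v) = Complex.exp (-(θ * Complex.I)) * evalAt θ v := by
  conv_rhs => rw [← shift.apply_symm_apply v, evalAt_shift, ← mul_assoc, ← Complex.exp_add]
  simp

theorem evalAt_shift_pow (θ : ℝ) (v : LaurentL1) (n : ℕ) :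
    evalAt θ ((shift ^ n) v) = Complex.exp (n * (θ * Complex.I)) * evalAt θ v := by
  induction n with
  | zero => simp
  | succ n ih =>
    rw [pow_succ', show (shift * shift ^ n) v = shift ((shift ^ n) v) from rfl, evalAt_shift, ih,
      ← mul_assoc, ← Complex.exp_add]
    push_cast
    ring_nf

theorem evalAt_single_zero (θ : ℝ) : evalAt θ (lp.single 1 0 1) = 1 := by
  change ∑' k : ℤ, ((lp.single 1 0 1 : LaurentL1) k : ℂ) * Complex.exp (k * (θ * Complex.I)) = 1
  rw [tsum_eq_single 0 fun k hk => by rw [lp.single_apply_ne _ _ _ hk]; simp]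
  rw [lp.single_apply_self]
  simp

theorem hasSum_re_evalAt (θ : ℝ) (v : LaurentL1) :
    HasSum (fun k : ℤ => v k * Real.cos (k * θ)) (evalAt θ v).re := by
  refine (Complex.hasSum_re (summable_laurent v θ).hasSum).congr_fun fun k => ?_
  rw [show (k : ℂ) * (θ * Complex.I) = ((k * θ : ℝ) : ℂ) * Complex.I by push_cast; ring,
    Complex.re_ofReal_mul, Complex.exp_ofReal_mul_I_re]

/-! ### From Laurent to Chebyshev coefficients -/

theorem chebSum_cos (p : Fin 2) (c : ℕ →₀ ℝ) (θ : ℝ) :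
    chebSum p c (Real.cos θ) = ∑ j ∈ c.support, c j * Real.cos ((2 * j + (p : ℕ) : ℤ) * θ) := by
  simp only [chebSum, Finsupp.sum, Chebyshev.T_real_cos]

theorem integral_cos_mul_cos (m n : ℤ) :
    ∫ θ in (0 : ℝ)..Real.pi, Real.cos (m * θ) * Real.cos (n * θ) =
      ((if m = n then Real.pi else 0) + if m = -n then Real.pi else 0) / 2 := by
  have key : ∀ k : ℤ, ∫ θ in (0 : ℝ)..Real.pi, Real.cos (k * θ) = if k = 0 then Real.pi else 0 := by
    intro k
    split_ifs with hk
    · simp [hk]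
    · rw [intervalIntegral.integral_comp_mul_left _ (Int.cast_ne_zero.2 hk), integral_cos]
      simp [Real.sin_int_mul_pi]
  have h1 : ∀ θ : ℝ, Real.cos (m * θ) * Real.cos (n * θ) =
      (Real.cos ((m - n : ℤ) * θ) + Real.cos ((m + n : ℤ) * θ)) / 2 := by
    intro θ
    push_cast
    rw [sub_mul, add_mul, Real.cos_sub, Real.cos_add]
    ring
  simp_rw [h1]
  rw [intervalIntegral.integral_div, intervalIntegral.integral_add
    (Continuous.intervalIntegrable (by fun_prop) _ _)
    (Continuous.intervalIntegrable (by fun_prop) _ _), key, key]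
  simp only [sub_eq_zero, add_eq_zero_iff_eq_neg]

/-- Orthogonality of the cosines: a finite cosine series equal to the real part of a Laurent series
has as its coefficients the sums of the Laurent coefficients of opposite index. -/
theorem coeff_eq_of_re_evalAt_eq {p : Fin 2} {c : ℕ →₀ ℝ} {v : LaurentL1}
    (h : ∀ θ ∈ Set.Icc 0 Real.pi, (evalAt θ v).re = chebSum p c (Real.cos θ)) (j : ℕ) :
    c j = ∑ k ∈ ({(2 * j + (p : ℕ) : ℤ), -(2 * j + (p : ℕ) : ℤ)} : Finset ℤ), v k := by
  set n : ℤ := 2 * j + (p : ℕ) with hn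
  set J : ℝ := ∫ θ in (0 : ℝ)..Real.pi, Real.cos (n * θ) * Real.cos (n * θ) with hJ
  have hJ0 : J ≠ 0 := by
    rw [hJ, integral_cos_mul_cos, if_pos rfl]
    have := Real.pi_pos
    split_ifs <;> positivity
  have hA : HasSum (fun k : ℤ => ∫ θ in (0 : ℝ)..Real.pi, v k * Real.cos (k * θ) * Real.cos (n * θ))
      (∫ θ in (0 : ℝ)..Real.pi, chebSum p c (Real.cos θ) * Real.cos (n * θ)) := by
    refine intervalIntegral.hasSum_integral_of_dominated_convergence (fun k _ => |v k|)
      (fun k => Continuous.aestronglyMeasurable (by fun_prop)) (fun k => ?_) ?_ ?_ ?_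
    · refine Filter.Eventually.of_forall fun θ _ => ?_
      rw [Real.norm_eq_abs, mul_assoc, abs_mul, abs_mul]
      exact mul_le_of_le_one_right (abs_nonneg _)
        (mul_le_one₀ (Real.abs_cos_le_one _) (abs_nonneg _) (Real.abs_cos_le_one _))
    · exact Filter.Eventually.of_forall fun θ _ => lp_one_summable v
    · exact intervalIntegrable_const
    · refine Filter.Eventually.of_forall fun θ hθ => ?_
      rw [Set.uIoc_of_le Real.pi_pos.le] at hθ
      rw [← h θ ⟨hθ.1.le, hθ.2⟩]
      exact (hasSum_re_evalAt θ v).mul_right _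
  have hB : ∫ θ in (0 : ℝ)..Real.pi, chebSum p c (Real.cos θ) * Real.cos (n * θ) = c j * J := by
    simp_rw [chebSum_cos, Finset.sum_mul, mul_assoc]
    rw [intervalIntegral.integral_finsetSum fun i _ =>
      Continuous.intervalIntegrable (by fun_prop) _ _]
    simp_rw [intervalIntegral.integral_const_mul]
    rw [Finset.sum_eq_single j]
    · intro i _ hi
      rw [integral_cos_mul_cos, if_neg (by lia), if_neg (by lia)]
      simp
    · intro hj
      simp [Finsupp.notMem_support_iff.1 hj]
  have hC : ∑' k : ℤ, ∫ θ in (0 : ℝ)..Real.pi, v k * Real.cos (k * θ) * Real.cos (n * θ) =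
      (∑ k ∈ ({n, -n} : Finset ℤ), v k) * J := by
    simp_rw [mul_assoc, intervalIntegral.integral_const_mul]
    rw [tsum_eq_sum (s := {n, -n}), Finset.sum_mul]
    · refine Finset.sum_congr rfl fun k hk => ?_
      rcases Finset.mem_insert.1 hk with rfl | hk
      · rfl
      · rw [Finset.mem_singleton.1 hk, hJ]
        simp
    · intro k hk
      simp only [Finset.mem_insert, Finset.mem_singleton, not_or] at hk
      rw [integral_cos_mul_cos, if_neg hk.1, if_neg hk.2]
      simp
  exact mul_right_cancel₀ hJ0 (by rw [← hB, ← hC, hA.tsum_eq])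

theorem toEll1_apply (Φ : ℕ →₀ ℝ) (k : ℕ) : toEll1 Φ k = Φ k := rfl

theorem norm_toEll1 (Φ : ℕ →₀ ℝ) {s : Finset ℕ} (hs : Φ.support ⊆ s) :
    ‖toEll1 Φ‖ = ∑ k ∈ s, |Φ k| := by
  rw [lp_one_norm_eq, tsum_eq_sum (s := s)]
  · rfl
  · intro k hk
    rw [toEll1_apply, Finsupp.notMem_support_iff.1 fun h => hk (hs h), abs_zero]

/-- Passing from Laurent coefficients to Chebyshev coefficients does not increase the `ℓ¹` norm. -/
theorem norm_toEll1_le_of_re_evalAt_eq {p : Fin 2} {c : ℕ →₀ ℝ} {v : LaurentL1}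
    (h : ∀ θ ∈ Set.Icc 0 Real.pi, (evalAt θ v).re = chebSum p c (Real.cos θ)) :
    ‖toEll1 c‖ ≤ ‖v‖ := by
  rw [norm_toEll1 c subset_rfl, lp_one_norm_eq]
  -- as finsets, `{n, -n}` counts the index `n = 0` once
  set I : ℕ → Finset ℤ := fun j => {(2 * j + (p : ℕ) : ℤ), -(2 * j + (p : ℕ) : ℤ)} with hI
  have hdisj : (c.support : Set ℕ).PairwiseDisjoint I := by
    intro i _ j _ hij
    refine Finset.disjoint_left.2 fun k hk hk' => hij ?_
    simp only [hI, Finset.mem_insert, Finset.mem_singleton] at hk hk'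
    lia
  calc ∑ j ∈ c.support, |c j| ≤ ∑ j ∈ c.support, ∑ k ∈ I j, |v k| :=
        Finset.sum_le_sum fun j _ => by
          rw [coeff_eq_of_re_evalAt_eq h j]
          exact Finset.abs_sum_le_sum_abs _ _
    _ = ∑ k ∈ c.support.biUnion I, |v k| := (Finset.sum_biUnion hdisj).symm
    _ ≤ ∑' k, |v k| := (lp_one_summable v).sum_le_tsum _ fun _ _ => abs_nonneg _

theorem chebSum_injective {p : Fin 2} {c c' : ℕ →₀ ℝ}
    (h : ∀ x ∈ Set.Icc (-1 : ℝ) 1, chebSum p c x = chebSum p c' x) : c = c' := by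
  refine sub_eq_zero.1 (Finsupp.ext fun j => ?_)
  have h0 := coeff_eq_of_re_evalAt_eq (p := p) (c := c - c') (v := 0) (fun θ _ => by
    rw [sub_eq_add_neg, ← neg_one_smul ℝ c', chebSum_add, chebSum_smul,
      h _ (Real.cos_mem_Icc θ), map_zero, Complex.zero_re]
    ring) j
  rw [h0]
  simp

/-! ### The map `F` on finitely supported sequences -/

/-- The symmetric phase factors as a sequence indexed by `ℕ`. -/
def fullSeq (p : Fin 2) (n : ℕ) (φ : ℕ → ℝ) (j : ℕ) : ℝ :=
  if 2 * j = 2 * n + (p : ℕ) then 2 * φ 0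
  else φ (Int.natAbs (2 * (j : ℤ) - (2 * (n : ℤ) + ((p : ℕ) : ℤ))) / 2)

theorem fullSeq_succ_succ (p : Fin 2) (n : ℕ) (φ : ℕ → ℝ) (j : ℕ) :
    fullSeq p (n + 1) φ (j + 1) = fullSeq p n φ j := by
  unfold fullSeq
  congr 1
  · rw [eq_iff_iff]; lia
  · congr 2; push_cast; congr 1; ring

theorem fullSeq_succ_zero (p : Fin 2) (n : ℕ) (φ : ℕ → ℝ) :
    fullSeq p (n + 1) φ 0 = φ (n + 1) := by
  have hp := p.2
  rw [fullSeq, if_neg (by lia)]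
  congr 1
  lia

theorem fullSeq_succ_last (p : Fin 2) (n : ℕ) (φ : ℕ → ℝ) :
    fullSeq p (n + 1) φ (2 * n + (p : ℕ) + 2) = φ (n + 1) := by
  have hp := p.2
  rw [fullSeq, if_neg (by lia)]
  congr 1
  lia

theorem fullSeq_sub (p : Fin 2) (n : ℕ) (φ φ' : ℕ → ℝ) (j : ℕ) :
    fullSeq p n φ j - fullSeq p n φ' j = fullSeq p n (fun k => φ k - φ' k) j := by
  unfold fullSeq
  split_ifs <;> ring

/-- A sum over the symmetric phases folds to twice a sum over the reduced phases. -/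
theorem sum_fullSeq (p : Fin 2) (φ : ℕ → ℝ) (G : ℝ → ℤ → ℝ) (hG : ∀ a k, G a (-k) = G a k)
    (hG2 : ∀ a, G (2 * a) 0 = 2 * G a 0) (n : ℕ) :
    ∑ j ∈ Finset.range (2 * n + (p : ℕ) + 1), G (fullSeq p n φ j) (2 * j - (2 * n + (p : ℕ))) =
      2 * ∑ k ∈ Finset.range (n + 1), G (φ k) (2 * k + (p : ℕ)) := by
  induction n with
  | zero =>
    fin_cases p
    · simp [fullSeq, hG2]
    · simp [fullSeq, Finset.sum_range_succ, hG, two_mul]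
  | succ n ih =>
    rw [show 2 * (n + 1) + (p : ℕ) + 1 = 2 * n + (p : ℕ) + 1 + 1 + 1 by ring,
      Finset.sum_range_succ, Finset.sum_range_succ', Finset.sum_range_succ _ (n + 1), mul_add, ← ih,
      fullSeq_succ_last, fullSeq_succ_zero, two_mul (G (φ (n + 1)) _), add_assoc]
    congr 1
    · refine Finset.sum_congr rfl fun j _ => ?_
      rw [fullSeq_succ_succ]
      push_cast
      ring_nf
    · congr 1
      · rw [← hG]
        push_cast
        ring_nf
      · push_cast
        ring_nf

theorem sum_abs_fullSeq (p : Fin 2) (n : ℕ) (φ : ℕ → ℝ) :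
    ∑ j ∈ Finset.range (2 * n + (p : ℕ) + 1), |fullSeq p n φ j| =
      2 * ∑ k ∈ Finset.range (n + 1), |φ k| :=
  sum_fullSeq p φ (fun a _ => |a|) (fun _ _ => rfl) (fun a => by simp [abs_mul]) n

/-- The initial vector of the recursion: `w⁻¹` compensates for the absence of a factor `W(x)` before
the first phase. -/
def initVec : LaurentL1 := shift.symm (lp.single 1 0 1)

theorem norm_initVec : ‖initVec‖ ≤ 1 := by
  rw [initVec, shift.symm.norm_map, lp.norm_single (by simp)]
  simp

theorem qspU_cos {θ : ℝ} (hθ : θ ∈ Set.Icc 0 Real.pi) (ψ : ℕ → ℝ) (d : ℕ) :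
    qspU (Real.cos θ) (fun j : Fin (d + 1) => ψ j) 0 0 =
      (evalAt θ (evolve shift initVec ψ (d + 1)).1).re +
        (evalAt θ (evolve shift initVec ψ (d + 1)).2).re * Complex.I ∧
    qspU (Real.cos θ) (fun j : Fin (d + 1) => ψ j) 0 1 =
      (evalAt θ (evolve shift initVec ψ (d + 1)).2).im +
        (evalAt θ (evolve shift initVec ψ (d + 1)).1).im * Complex.I := by
  have hexp : ∀ x : ℝ, Complex.exp (Complex.I * x) = Real.cos x + Real.sin x * Complex.I := by
    intro x
    rw [mul_comm, Complex.exp_mul_I, Complex.ofReal_cos, Complex.ofReal_sin]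
  have hexp' : ∀ x : ℝ, Complex.exp (-(Complex.I * x)) = Real.cos x - Real.sin x * Complex.I := by
    intro x
    rw [show -(Complex.I * x) = Complex.I * ((-x : ℝ) : ℂ) by push_cast; ring, hexp, Real.cos_neg,
      Real.sin_neg]
    push_cast
    ring
  induction d with
  | zero =>
    have h1 : evolve shift initVec ψ (0 + 1) =
        (Real.cos (ψ 0) • lp.single 1 0 1, Real.sin (ψ 0) • lp.single 1 0 1) := by
      simp [evolve, initVec]
    rw [h1]
    simp only [map_smul, evalAt_single_zero]
    simp [qspU, expZ, hexp, -Complex.ofReal_cos, -Complex.ofReal_sin]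
  | succ d ih =>
    obtain ⟨h0, h1⟩ := ih
    have hs : Real.sqrt (1 - Real.cos θ ^ 2) = Real.sin θ := by
      rw [← Real.sin_sq, Real.sqrt_sq (Real.sin_nonneg_of_mem_Icc hθ)]
    have hrec : qspU (Real.cos θ) (fun j : Fin (d + 1 + 1) => ψ j) =
        qspU (Real.cos θ) (fun j : Fin (d + 1) => ψ j) *
          (W (Real.cos θ) * expZ (ψ (d + 1))) := qspU_succ _ _
    rw [hrec, evolve]
    generalize (evolve shift initVec ψ (d + 1)).1 = C at *
    generalize (evolve shift initVec ψ (d + 1)).2 = S at *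
    simp only [map_add, map_sub, map_smul, evalAt_shift, evalAt_shift_symm, Matrix.mul_apply,
      Fin.sum_univ_two, h0, h1, W, expZ, hs, Matrix.of_apply, Matrix.cons_val_zero,
      Matrix.cons_val_one, Matrix.cons_val', Matrix.cons_val_fin_one, mul_comm (θ : ℂ) Complex.I,
      hexp, hexp']
    constructor <;> apply Complex.ext <;>
      simp [-Complex.ofReal_cos, -Complex.ofReal_sin] <;> ring

theorem g_cos (p : Fin 2) (n : ℕ) (φ : ℕ → ℝ) {θ : ℝ} (hθ : θ ∈ Set.Icc 0 Real.pi) :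
    g p n (Real.cos θ) φ =
      (evalAt θ (evolve shift initVec (fullSeq p n φ) (2 * n + (p : ℕ) + 1)).2).re := by
  have h := (qspU_cos hθ (fullSeq p n φ) (2 * n + (p : ℕ))).1
  rw [g, gFull, show fullPhases p n φ = fun j : Fin _ => fullSeq p n φ j from rfl, h]
  simp

/-- Adding a zero phase at both ends does not change the odd part: the first one multiplies it by
`w`, the last one by `w⁻¹`. -/
theorem evolve_fullSeq_succ (p : Fin 2) (n : ℕ) {φ : ℕ → ℝ} (h : φ (n + 1) = 0) :
    (evolve shift initVec (fullSeq p (n + 1) φ) (2 * (n + 1) + (p : ℕ) + 1)).2 =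
      (evolve shift initVec (fullSeq p n φ) (2 * n + (p : ℕ) + 1)).2 := by
  have h0 : fullSeq p (n + 1) φ 0 = 0 := by rw [fullSeq_succ_zero, h]
  have h1 : fullSeq p (n + 1) φ (2 * n + (p : ℕ) + 1 + 1) = 0 := by
    rw [← h, ← fullSeq_succ_last p n φ]
  rw [show 2 * (n + 1) + (p : ℕ) + 1 = 2 * n + (p : ℕ) + 1 + 1 + 1 by ring, evolve, h1,
    evolve_succ_of_zero h0, evolve_map_apply]
  simp [fullSeq_succ_succ]

theorem g_eq_of_le {p : Fin 2} {φ : ℕ → ℝ} {m n : ℕ} (hmn : m ≤ n) (h : ∀ k, m < k → φ k = 0)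
    {x : ℝ} (hx : x ∈ Set.Icc (-1 : ℝ) 1) : g p n x φ = g p m x φ := by
  rw [← Real.cos_arccos hx.1 hx.2]
  have hθ : Real.arccos x ∈ Set.Icc 0 Real.pi := ⟨Real.arccos_nonneg x, Real.arccos_le_pi x⟩
  rw [g_cos p n φ hθ, g_cos p m φ hθ]
  congr 2
  induction n, hmn using Nat.le_induction with
  | base => rfl
  | succ n hmn ih => rw [evolve_fullSeq_succ p n (h _ (by lia)), ih]

theorem eq_zero_of_lastIndex_lt {Φ : ℕ →₀ ℝ} {k : ℕ} (hk : lastIndex Φ < k) : Φ k = 0 := by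
  by_contra h0
  exact absurd (Finset.le_sup (f := id) (Finsupp.mem_support_iff.2 h0)) (not_le.2 hk)

theorem g_eq_chebSum_F (p : Fin 2) {Φ : ℕ →₀ ℝ} {n : ℕ} (h : ∀ k, n < k → Φ k = 0)
    {x : ℝ} (hx : x ∈ Set.Icc (-1 : ℝ) 1) : g p n x Φ = chebSum p (F p Φ) x := by
  have hF : g p (lastIndex Φ) x Φ = chebSum p (F p Φ) x := (exists_chebCoeffs p Φ).choose_spec x hx
  rw [← hF]
  rcases le_total n (lastIndex Φ) with hn | hn
  · exact (g_eq_of_le hn h hx).symm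
  · exact g_eq_of_le hn (fun k => eq_zero_of_lastIndex_lt) hx

theorem g_eq_chebSum_iff (p : Fin 2) (Φ c : ℕ →₀ ℝ) (n : ℕ) (h : ∀ k, n < k → Φ k = 0) :
    (∀ x ∈ Set.Icc (-1 : ℝ) 1, g p n x Φ = chebSum p c x) ↔ c = F p Φ := by
  refine ⟨fun hc => chebSum_injective (p := p) fun x hx => ?_, ?_⟩
  · rw [← hc x hx, g_eq_chebSum_F p h hx]
  · rintro rfl x hx
    exact g_eq_chebSum_F p h hx

theorem evalAt_evolveLin (θ : ℝ) (ψ : ℕ → ℝ) (k : ℕ) :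
    evalAt θ (evolveLin shift initVec ψ k) =
      ∑ j ∈ Finset.range k, (ψ j : ℂ) * Complex.exp ((2 * j - k + 1) * (θ * Complex.I)) := by
  induction k with
  | zero => simp [evolveLin]
  | succ k ih =>
    rw [evolveLin, map_add, map_smul, evalAt_shift_symm, ih, Finset.sum_range_succ,
      Finset.mul_sum, evalAt_shift_pow, initVec, evalAt_shift_symm, evalAt_single_zero]
    congr 1
    · refine Finset.sum_congr rfl fun j _ => ?_
      rw [mul_left_comm, ← Complex.exp_add]
      push_cast
      ring_nf
    · rw [mul_one, ← Complex.exp_add, Complex.real_smul]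
      push_cast
      ring_nf

/-- The linear part of `F` is multiplication by `2`, since every reduced phase occurs twice. -/
theorem re_evalAt_evolveLin_fullSeq (p : Fin 2) {Φ : ℕ →₀ ℝ} {n : ℕ} (h : ∀ k, n < k → Φ k = 0)
    (θ : ℝ) :
    (evalAt θ (evolveLin shift initVec (fullSeq p n Φ) (2 * n + (p : ℕ) + 1))).re =
      2 * chebSum p Φ (Real.cos θ) := by
  have h1 := sum_fullSeq p Φ (fun a k => a * Real.cos (k * θ)) (fun a k => by simp)
    (fun a => by ring) n
  have h2 : chebSum p Φ (Real.cos θ) =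
      ∑ k ∈ Finset.range (n + 1), Φ k * Real.cos ((2 * k + (p : ℕ) : ℤ) * θ) := by
    rw [chebSum_cos]
    refine Finset.sum_subset (fun k hk => ?_) fun k _ hk => ?_
    · rw [Finset.mem_range, Nat.lt_succ_iff]
      by_contra hkn
      exact Finsupp.mem_support_iff.1 hk (h k (not_le.1 hkn))
    · rw [Finsupp.notMem_support_iff.1 hk, zero_mul]
  rw [h2, ← h1, evalAt_evolveLin, Complex.re_sum]
  refine Finset.sum_congr rfl fun j _ => ?_
  rw [Complex.re_ofReal_mul, show (2 * (j : ℂ) - (2 * n + (p : ℕ) + 1 : ℕ) + 1) *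
    (θ * Complex.I) = (((2 * (j : ℤ) - (2 * n + (p : ℕ)) : ℤ) * θ : ℝ) : ℂ) * Complex.I by
      push_cast; ring, Complex.exp_ofReal_mul_I_re]

theorem toEll1_sub (Φ Φ' : ℕ →₀ ℝ) : toEll1 (Φ - Φ') = toEll1 Φ - toEll1 Φ' := rfl

theorem toEll1_smul (a : ℝ) (Φ : ℕ →₀ ℝ) : toEll1 (a • Φ) = a • toEll1 Φ := rfl

theorem chebSum_sub (p : Fin 2) (c c' : ℕ →₀ ℝ) (x : ℝ) :
    chebSum p (c - c') x = chebSum p c x - chebSum p c' x := by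
  rw [sub_eq_add_neg, ← neg_one_smul ℝ c', chebSum_add, chebSum_smul]
  ring

theorem sum_abs_fullSeq_eq_norm (p : Fin 2) {Φ : ℕ →₀ ℝ} {n : ℕ} (h : ∀ k, n < k → Φ k = 0) :
    ∑ j ∈ Finset.range (2 * n + (p : ℕ) + 1), |fullSeq p n Φ j| = 2 * ‖toEll1 Φ‖ := by
  rw [sum_abs_fullSeq, norm_toEll1 Φ fun k hk => ?_]
  rw [Finset.mem_range, Nat.lt_succ_iff]
  by_contra hkn
  exact Finsupp.mem_support_iff.1 hk (h k (not_le.1 hkn))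

/-- `F - 2` grows at most like its majorant `sinh (2 r) - 2 r`. -/
theorem norm_F_sub_two_smul_le (p : Fin 2) (Φ : ℕ →₀ ℝ) :
    ‖toEll1 (F p Φ) - (2 : ℝ) • toEll1 Φ‖ ≤ Real.sinh (2 * ‖toEll1 Φ‖) - 2 * ‖toEll1 Φ‖ := by
  set n := lastIndex Φ
  have hn : ∀ k, n < k → Φ k = 0 := fun k => eq_zero_of_lastIndex_lt
  rw [← toEll1_smul, ← toEll1_sub, ← sum_abs_fullSeq_eq_norm p hn]
  refine (norm_toEll1_le_of_re_evalAt_eq (p := p) fun θ hθ => ?_).trans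
    (evolve_bounds (τ := shift) norm_initVec (fullSeq p n Φ) (2 * n + (p : ℕ) + 1)).2.2.2
  rw [map_sub, Complex.sub_re, ← g_cos p n Φ hθ, re_evalAt_evolveLin_fullSeq p hn, chebSum_sub,
    chebSum_smul, g_eq_chebSum_F p hn (Real.cos_mem_Icc θ)]

/-- `F - 2` is Lipschitz with constant `h r` on the ball of radius `r`. -/
theorem norm_F_sub_F_sub_le (p : Fin 2) (Φ Φ' : ℕ →₀ ℝ) :
    ‖toEll1 (F p Φ) - toEll1 (F p Φ') - (2 : ℝ) • (toEll1 Φ - toEll1 Φ')‖ ≤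
      h (max ‖toEll1 Φ‖ ‖toEll1 Φ'‖) * ‖toEll1 Φ - toEll1 Φ'‖ := by
  set n := max (lastIndex Φ) (lastIndex Φ')
  have hn : ∀ k, n < k → Φ k = 0 := fun k hk =>
    eq_zero_of_lastIndex_lt ((le_max_left _ _).trans_lt hk)
  have hn' : ∀ k, n < k → Φ' k = 0 := fun k hk =>
    eq_zero_of_lastIndex_lt ((le_max_right _ _).trans_lt hk)
  have hnd : ∀ k, n < k → (Φ - Φ') k = 0 := fun k hk => by
    rw [Finsupp.sub_apply, hn k hk, hn' k hk, sub_zero]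
  have hbound := norm_evolve_sub_sub_le (τ := shift) norm_initVec (fullSeq p n Φ)
    (fullSeq p n Φ') (2 * n + (p : ℕ) + 1) (s := 2 * max ‖toEll1 Φ‖ ‖toEll1 Φ'‖)
    (by rw [sum_abs_fullSeq_eq_norm p hn]; gcongr; exact le_max_left _ _)
    (by rw [sum_abs_fullSeq_eq_norm p hn']; gcongr; exact le_max_right _ _)
  simp only [fullSeq_sub] at hbound
  change ‖_ - evolveLin shift initVec (fullSeq p n ⇑(Φ - Φ')) _‖ ≤
    _ * ∑ j ∈ _, |fullSeq p n ⇑(Φ - Φ') j| at hbound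
  rw [sum_abs_fullSeq_eq_norm p hnd] at hbound
  rw [← toEll1_sub, ← toEll1_sub, ← toEll1_smul, ← toEll1_sub]
  refine ((norm_toEll1_le_of_re_evalAt_eq (p := p) fun θ hθ => ?_).trans hbound).trans_eq ?_
  · rw [map_sub, map_sub, Complex.sub_re, Complex.sub_re, ← g_cos p n Φ hθ, ← g_cos p n Φ' hθ,
      re_evalAt_evolveLin_fullSeq p hnd, g_eq_chebSum_F p hn (Real.cos_mem_Icc θ),
      g_eq_chebSum_F p hn' (Real.cos_mem_Icc θ), chebSum_sub, chebSum_sub,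
      chebSum_smul, chebSum_sub, chebSum_sub]
  · rw [h]
    ring

/-! ### Extension to `ℓ¹` -/

open Filter Topology

theorem denseRange_toEll1 : DenseRange toEll1 := by
  intro v
  refine mem_closure_of_tendsto (lp.hasSum_single ENNReal.one_ne_top v)
    (Eventually.of_forall fun s => ⟨∑ k ∈ s, Finsupp.single k (v k), ?_⟩)
  have hadd : ∀ a b : ℕ →₀ ℝ, toEll1 (a + b) = toEll1 a + toEll1 b := fun _ _ => rfl
  induction s using Finset.cons_induction with
  | empty => rfl
  | cons k s hk ih =>
    rw [Finset.sum_cons, Finset.sum_cons, hadd, ih]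
    congr 1
    ext j
    rw [toEll1_apply, lp.single_apply, Finsupp.single_apply]
    simp [Pi.single_apply, eq_comm]

/-- A map on a dense subset that differs from `2` by a locally Lipschitz map, with constant `ω r` on
the ball of radius `r`, extends to the whole space with the same estimate. -/
theorem exists_extension {α V : Type*} [NormedAddCommGroup V] [NormedSpace ℝ V] [CompleteSpace V]
    {ι f : α → V} (hι : DenseRange ι) {ω : ℝ → ℝ} (hω : Continuous ω)
    (hf : ∀ a b, ‖f a - f b - (2 : ℝ) • (ι a - ι b)‖ ≤ ω (max ‖ι a‖ ‖ι b‖) * ‖ι a - ι b‖) :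
    ∃ G : V → V, Continuous G ∧ (∀ a, G (ι a) = f a) ∧
      ∀ v w, ‖G v - G w - (2 : ℝ) • (v - w)‖ ≤ ω (max ‖v‖ ‖w‖) * ‖v - w‖ := by
  have hnorm : ∀ x y : V, ‖x‖ ≤ ‖x - (2 : ℝ) • y‖ + 2 * ‖y‖ := fun x y => by
    have := norm_le_norm_sub_add x ((2 : ℝ) • y)
    rwa [norm_smul, Real.norm_of_nonneg zero_le_two] at this
  have hex : ∀ v : V, ∃ u : ℕ → α, Tendsto (fun n => ι (u n)) atTop (𝓝 v) := fun v => by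
    obtain ⟨x, hx, hlim⟩ := mem_closure_iff_seq_limit.1 (hι v)
    choose u hu using hx
    exact ⟨u, by simpa only [hu] using hlim⟩
  choose u hu using hex
  have hlim : ∀ v, ∃ y, Tendsto (fun n => f (u v n)) atTop (𝓝 y) := fun v => by
    refine cauchySeq_tendsto_of_complete (cauchySeq_iff_tendsto_dist_atTop_0.2 ?_)
    have h1 : Tendsto (fun n : ℕ × ℕ => ι (u v n.1)) atTop (𝓝 v) :=
      (hu v).comp (by rw [← prod_atTop_atTop_eq]; exact tendsto_fst)
    have h2 : Tendsto (fun n : ℕ × ℕ => ι (u v n.2)) atTop (𝓝 v) :=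
      (hu v).comp (by rw [← prod_atTop_atTop_eq]; exact tendsto_snd)
    have h3 := (h1.sub h2).norm
    have h4 := (((hω.tendsto _).comp (h1.norm.max h2.norm)).mul h3).add (h3.const_mul 2)
    rw [sub_self, norm_zero, mul_zero, mul_zero, add_zero] at h4
    refine squeeze_zero (fun _ => dist_nonneg) (fun n => ?_) h4
    rw [dist_eq_norm]
    exact (hnorm _ (ι (u v n.1) - ι (u v n.2))).trans (add_le_add (hf _ _) le_rfl)
  choose G hG using hlim
  have hbound : ∀ v w, ‖G v - G w - (2 : ℝ) • (v - w)‖ ≤ ω (max ‖v‖ ‖w‖) * ‖v - w‖ := fun v w =>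
    le_of_tendsto_of_tendsto' (((hG v).sub (hG w)).sub (((hu v).sub (hu w)).const_smul 2)).norm
      (((hω.tendsto _).comp ((hu v).norm.max (hu w).norm)).mul ((hu v).sub (hu w)).norm)
      fun n => hf _ _
  refine ⟨G, ?_, fun a => ?_, hbound⟩
  · refine continuous_iff_continuousAt.2 fun v => tendsto_iff_norm_sub_tendsto_zero.2 ?_
    have h0 : Tendsto (fun w => ω (max ‖w‖ ‖v‖) * ‖w - v‖ + 2 * ‖w - v‖) (𝓝 v)
        (𝓝 (ω (max ‖v‖ ‖v‖) * ‖v - v‖ + 2 * ‖v - v‖)) :=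
      Continuous.tendsto (by fun_prop) v
    rw [sub_self, norm_zero, mul_zero, mul_zero, add_zero] at h0
    exact squeeze_zero (fun _ => norm_nonneg _)
      (fun w => (hnorm _ (w - v)).trans (add_le_add (hbound _ _) le_rfl)) h0
  · have h1 := (((hG (ι a)).sub_const (f a)).sub (((hu (ι a)).sub_const (ι a)).const_smul (2 : ℝ))).norm
    have h2 := ((hω.tendsto _).comp ((hu (ι a)).norm.max (tendsto_const_nhds (x := ‖ι a‖)))).mul
      ((hu (ι a)).sub_const (ι a)).norm
    have := le_of_tendsto_of_tendsto' h1 h2 fun n => hf _ _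
    simpa [sub_eq_zero] using this

/-! ### Inversion of perturbations of `2` -/

theorem h_nonneg (x : ℝ) : 0 ≤ h x := by
  rw [h]
  linarith [Real.one_le_cosh (2 * x)]

theorem h_lt_two {x : ℝ} (hx : 0 ≤ x) (hx' : x < rPhi) : h x < 2 :=
  rPhi_spec.2 ▸ h_strictMonoOn hx rPhi_spec.1 hx'

theorem h_le_h {x y : ℝ} (hx : 0 ≤ x) (hxy : x ≤ y) : h x ≤ h y :=
  h_strictMonoOn.monotoneOn hx (hx.trans hxy) hxy

theorem HInv_lt_rPhi {y : ℝ} (hy : 0 ≤ y) (hy' : y < rc) : HInv y < rPhi := by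
  obtain ⟨h1, h2⟩ := HInv_spec ⟨hy, hy'.le⟩
  refine lt_of_le_of_ne h1.2 fun heq => hy'.ne ?_
  rw [← h2, heq, rc]

section Inverse

variable {V : Type*} [NormedAddCommGroup V] [NormedSpace ℝ V] {G : V → V}

theorem eq_of_mem_ball_of_map_eq
    (hL : ∀ v w, ‖G v - G w - (2 : ℝ) • (v - w)‖ ≤ h (max ‖v‖ ‖w‖) * ‖v - w‖) {v w : V}
    (hv : ‖v‖ < rPhi) (hw : ‖w‖ < rPhi) (hvw : G v = G w) : v = w := by
  have h1 := hL v w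
  rw [hvw, sub_self, zero_sub, norm_neg, norm_smul, Real.norm_of_nonneg zero_le_two] at h1
  have h2 := h_lt_two ((norm_nonneg v).trans (le_max_left _ ‖w‖)) (max_lt hv hw)
  by_contra hne
  have h3 := norm_pos_iff.2 (sub_ne_zero.2 hne)
  nlinarith

/-- Solutions of `G v = c` are the fixed points of `v ↦ v + (c - G v) / 2`, a contraction of the
closed ball of radius `H⁻¹ ‖c‖`. -/
theorem exists_map_eq [CompleteSpace V]
    (hL : ∀ v w, ‖G v - G w - (2 : ℝ) • (v - w)‖ ≤ h (max ‖v‖ ‖w‖) * ‖v - w‖)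
    (hS : ∀ v, ‖G v - (2 : ℝ) • v‖ ≤ Real.sinh (2 * ‖v‖) - 2 * ‖v‖) {c : V} (hc : ‖c‖ < rc) :
    ∃ v, ‖v‖ ≤ HInv ‖c‖ ∧ G v = c := by
  obtain ⟨hρ, hHρ⟩ := HInv_spec ⟨norm_nonneg c, hc.le⟩
  have hρlt := HInv_lt_rPhi (norm_nonneg c) hc
  set ρ := HInv ‖c‖
  set T : V → V := fun v => (2⁻¹ : ℝ) • (c - (G v - (2 : ℝ) • v)) with hT
  have hhalf : ∀ x : V, ‖(2⁻¹ : ℝ) • x‖ = ‖x‖ / 2 := fun x => by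
    rw [norm_smul, Real.norm_of_nonneg (by norm_num)]; ring
  have hmono : ∀ r, r ≤ ρ → Real.sinh (2 * r) - 2 * r ≤ Real.sinh (2 * ρ) - 2 * ρ := fun r hr =>
    Real.sinh_sub_id_strictMono.monotone (by linarith)
  -- the radius is preserved because `H ρ = ‖c‖` means `‖c‖ + (sinh (2 ρ) - 2 ρ) = 2 ρ`
  have hmaps : Set.MapsTo T (Metric.closedBall 0 ρ) (Metric.closedBall 0 ρ) := by
    intro v hv
    rw [mem_closedBall_zero_iff] at hv ⊢
    rw [hT, hhalf]
    have h1 := norm_sub_le c (G v - (2 : ℝ) • v)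
    have h2 := hS v
    have h3 := hmono _ hv
    rw [H] at hHρ
    linarith
  have hK : h ρ / 2 < 1 := by linarith [h_lt_two hρ.1 hρlt]
  have hK0 : 0 ≤ h ρ / 2 := by linarith [h_nonneg ρ]
  have hcontr : ContractingWith ⟨h ρ / 2, hK0⟩ (hmaps.restrict T _ _) := by
    refine ⟨by exact_mod_cast hK, LipschitzWith.of_dist_le_mul fun v w => ?_⟩
    have hv := mem_closedBall_zero_iff.1 v.2
    have hw := mem_closedBall_zero_iff.1 w.2
    rw [Subtype.dist_eq, Subtype.dist_eq, dist_eq_norm, dist_eq_norm]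
    change ‖T v - T w‖ ≤ h ρ / 2 * _
    have e1 : T v - T w = -((2⁻¹ : ℝ) • (G v - G w - (2 : ℝ) • ((v : V) - w))) := by
      simp only [hT]
      module
    rw [e1, norm_neg, hhalf]
    have h1 := hL v w
    have h2 := mul_le_mul_of_nonneg_right
      (h_le_h ((norm_nonneg _).trans (le_max_left _ _)) (max_le hv hw)) (norm_nonneg ((v : V) - w))
    linarith
  obtain ⟨v, hv, hfix, -⟩ := hcontr.exists_fixedPoint' Metric.isClosed_closedBall.isComplete hmaps
    (Metric.mem_closedBall_self hρ.1) (edist_ne_top _ _)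
  refine ⟨v, mem_closedBall_zero_iff.1 hv, ?_⟩
  have h1 : T v = v := hfix
  have h2 : c - G v = (2 : ℝ) • (T v - v) := by
    simp only [hT]
    module
  rw [h1, sub_self, smul_zero, sub_eq_zero] at h2
  exact h2.symm

end Inverse

/-! ### The value of `r_c` and the conclusion -/

theorem abs_rc_sub_lt : |rc - 0.902| < 0.0005 := by
  obtain ⟨h0, h2⟩ := rPhi_spec
  -- `y = 2 r_Φ` satisfies `cosh y = 2`, hence `exp y = 2 + √3` and `r_c = 2 y - √3`
  set y := 2 * rPhi with hy
  have hcosh : Real.cosh y = 2 := by rw [h] at h2; linarith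
  have hsinh : Real.sinh y = √3 := by
    rw [eq_comm, Real.sqrt_eq_iff_mul_self_eq (by norm_num)
      (Real.sinh_nonneg_iff.2 (by linarith))]
    have := Real.cosh_sq y
    rw [hcosh] at this
    linarith
  have hexp : Real.exp y = 2 + √3 := by rw [← Real.cosh_add_sinh, hcosh, hsinh]
  have hrc : rc = 2 * y - √3 := by rw [rc, H, ← hy, hsinh]; ring
  have s1 : (1.73205 : ℝ) < √3 := Real.lt_sqrt_of_sq_lt (by norm_num)
  have s2 : √3 < (1.732051 : ℝ) := (Real.sqrt_lt' (by norm_num)).2 (by norm_num)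
  have hlo : (1.3168 : ℝ) < y := by
    refine Real.exp_lt_exp.1 ?_
    rw [hexp, show (1.3168 : ℝ) = 1 + 0.3168 by norm_num, Real.exp_add]
    have e1 := Real.exp_one_lt_d9
    have e2 := Real.exp_bound' (x := 0.3168) (by norm_num) (by norm_num) (n := 6) (by norm_num)
    have e3 : Real.exp 0.3168 < 1.37274 := by
      refine e2.trans_lt ?_
      norm_num [Finset.sum_range_succ, Nat.factorial]
    have := Real.exp_pos 0.3168
    nlinarith
  have hhi : y < (1.3172 : ℝ) := by
    refine Real.exp_lt_exp.1 ?_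
    rw [hexp, show (1.3172 : ℝ) = 1 + 0.3172 by norm_num, Real.exp_add]
    have e1 := Real.exp_one_gt_d9
    have e2 := Real.sum_le_exp_of_nonneg (x := 0.3172) (by norm_num) 6
    have e3 : 1.37327 < Real.exp 0.3172 := by
      refine lt_of_lt_of_le ?_ e2
      norm_num [Finset.sum_range_succ, Nat.factorial]
    nlinarith
  rw [hrc, abs_lt]
  constructor <;> linarith

/-- The continuous extension of `F` to `ℓ¹`, with the two estimates that make it invertible near
`0`. -/
theorem exists_Fbar (p : Fin 2) : ∃ G : ell1 → ell1, Continuous G ∧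
    (∀ Φ : ℕ →₀ ℝ, G (toEll1 Φ) = toEll1 (F p Φ)) ∧
    (∀ v w, ‖G v - G w - (2 : ℝ) • (v - w)‖ ≤ h (max ‖v‖ ‖w‖) * ‖v - w‖) ∧
    ∀ v, ‖G v - (2 : ℝ) • v‖ ≤ Real.sinh (2 * ‖v‖) - 2 * ‖v‖ := by
  have hh : Continuous h := by unfold h; fun_prop
  obtain ⟨G, hG, hGF, hL⟩ := exists_extension (f := fun Φ => toEll1 (F p Φ)) denseRange_toEll1 hh
    (norm_F_sub_F_sub_le p)
  refine ⟨G, hG, hGF, hL, fun v => ?_⟩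
  refine denseRange_toEll1.induction_on v (isClosed_le (by fun_prop) (by fun_prop)) fun Φ => ?_
  rw [hGF]
  exact norm_F_sub_two_smul_le p Φ

end

end QSP

theorem theorem1 (p : Fin 2) :
    (∀ (Φ c : ℕ →₀ ℝ) (n : ℕ), (∀ k, n < k → Φ k = 0) →
      ((∀ x ∈ Set.Icc (-1 : ℝ) 1, QSP.g p n x Φ = QSP.chebSum p c x) ↔ c = QSP.F p Φ)) ∧
    |QSP.rc - 0.902| < 0.0005 ∧
    ∃ Fbar : QSP.ell1 → QSP.ell1,
      Continuous Fbar ∧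
      (∀ Φ : ℕ →₀ ℝ, Fbar (QSP.toEll1 Φ) = QSP.toEll1 (QSP.F p Φ)) ∧
      (∀ G : QSP.ell1 → QSP.ell1, Continuous G →
        (∀ Φ : ℕ →₀ ℝ, G (QSP.toEll1 Φ) = QSP.toEll1 (QSP.F p Φ)) → G = Fbar) ∧
      ∃ FbarInv : Metric.ball (0 : QSP.ell1) QSP.rc → QSP.ell1,
        (∀ c, FbarInv c ∈ Metric.ball (0 : QSP.ell1) QSP.rPhi ∧ Fbar (FbarInv c) = c ∧
          ‖FbarInv c‖ ≤ QSP.HInv ‖(c : QSP.ell1)‖) ∧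
        (∀ Φ ∈ Metric.ball (0 : QSP.ell1) QSP.rPhi,
          ∀ hΦ : Fbar Φ ∈ Metric.ball (0 : QSP.ell1) QSP.rc, FbarInv ⟨Fbar Φ, hΦ⟩ = Φ) := by
  obtain ⟨G, hG, hGF, hL, hS⟩ := QSP.exists_Fbar p
  choose inv hinv hGinv using fun c : Metric.ball (0 : QSP.ell1) QSP.rc =>
    QSP.exists_map_eq hL hS (mem_ball_zero_iff.1 c.2)
  have hlt : ∀ c, ‖inv c‖ < QSP.rPhi := fun c =>
    (hinv c).trans_lt (QSP.HInv_lt_rPhi (norm_nonneg _) (mem_ball_zero_iff.1 c.2))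
  refine ⟨QSP.g_eq_chebSum_iff p, QSP.abs_rc_sub_lt, G, hG, hGF, fun G' hG' hGF' => ?_, inv,
    fun c => ⟨mem_ball_zero_iff.2 (hlt c), hGinv c, hinv c⟩, fun Φ hΦ hc => ?_⟩
  · exact QSP.denseRange_toEll1.equalizer hG' hG (funext fun Φ => (hGF' Φ).trans (hGF Φ).symm)
  · exact QSP.eq_of_mem_ball_of_map_eq hL (hlt _) (mem_ball_zero_iff.1 hΦ) (hGinv _)
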